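/- Let $k\ge 2$ be an integer. Notation and conventions: * $m(\cdot)$, $dm$ denote Lebesgue measure on $\mathbb R^k$, and $H^k$ is the $k$-dimensional Hausdorff measure, normalized as $H^k(X)=\sup_{\varepsilon>0}\inf\sum_i(\operatorname{diam}X_i)^k$, where the infimum is over countable coverings of $X$ by sets $X_i$ of diameter less than $\varepsilon$. * For an open set $\Omega\subset\mathbb R^k$ and $\varphi:[0,\infty)\to[0,\infty)$, a map $f=(f_1,\dots,f_m):\Omega\to\mathbb R^m$ is in the class $W^{1,\varphi}(\Omega)$ if every $f_i$ is locally integrable in $\Omega$ and has locally integrable first distributional derivatives in $\Omega$, and $\int_\Omega\varphi(|\nabla f|)\,dm<\infty$, where $|\nabla f|=\bigl(\sum_{i,j}(\partial f_i/\partial x_j)^2\bigr)^{1/2}$. * A number $\alpha\ge0$ is called a Calderón constant for $k$ if $$\operatorname{diam} f(C)\le\alpha\left(\int_0^\infty\left[\frac{t}{\varphi(t)}\right]^{\frac1{k-1}}dt\right)^{\frac{k-1}{k}}\left(\int_C\varphi(|\nabla f|)\,dm\right)^{\frac1k}$$ for every non-decreasing $\varphi:[0,\infty)\to[0,\infty)$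 with $\varphi(0)=0$ and $\int_0^\infty[t/\varphi(t)]^{1/(k-1)}dt<\infty$, every domain $G\subset\mathbb R^k$, every continuous real-valued $f\in W^{1,\varphi}(G)$, and every closed cube $C\subset G$ with edges parallel to the coordinate axes. **Theorem 4.1.** There is a Calderón constant for $k$. Moreover, let $\alpha_k$ be any Calderón constant for $k$, let $m\ge1$, let $\Omega\subset\mathbb R^k$ be open, let $\varphi:[0,\infty)\to[0,\infty)$ be non-decreasing with $\varphi(0)=0$, $\varphi(1)>0$ and $$A:=\int_1^\infty\left[\frac{t}{\varphi(t)}\right]^{\frac1{k-1}}dt<\infty,$$ and let $f:\Omega\to\mathbb R^m$ be continuous and in the class $W^{1,\varphi}(\Omega)$. Put $A_*:=A+[1/\varphi(1)]^{1/(k-1)}$, and $\varphi_*(0):=0$, $\varphi_*(t):=\varphi(1)$ for $0<t<1$, $\varphi_*(t):=\varphi(t)$ for $t\ge1$. Then: 1. $H^k(f(E))\le(m\alpha_k)^k\,A_*^{k-1}\int_E\varphi_*(|\nabla f|)\,dm$ for every Lebesgue measurable set $E\subset\Omega$ (the right-hand side may be $+\infty$); 2. $f$ has the Lusin $(N)$-property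 with respect to $H^k$: if $E\subset\Omega$ and $m(E)=0$, then $H^k(f(E))=0$; 3. if $E\subset\Omega$ is Lebesgue measurable and $\nabla f=0$ a.e. on $E$, then $H^k(f(E))=0$. -/

import Mathlib

open MeasureTheory Set
open scoped ENNReal NNReal ContDiff

noncomputable section

namespace OrliczSobolev

/-- `g` is the `j`-th distributional partial derivative of `u` in `Ω`; both functions are
required to be locally integrable in `Ω`. -/
def IsWeakPartialDeriv {k : ℕ} (Ω : Set (EuclideanSpace ℝ (Fin k)))
    (u g : EuclideanSpace ℝ (Fin k) → ℝ) (j : Fin k) : Prop :=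
  LocallyIntegrableOn u Ω volume ∧ LocallyIntegrableOn g Ω volume ∧
    ∀ ψ : EuclideanSpace ℝ (Fin k) → ℝ,
      ContDiff ℝ ∞ ψ → HasCompactSupport ψ → tsupport ψ ⊆ Ω →
        ∫ x in Ω, u x * fderiv ℝ ψ x (EuclideanSpace.single j 1) = -∫ x in Ω, g x * ψ x

/-- The Euclidean (Frobenius) length of a gradient matrix: the square root of the sum of the
squares of its entries. -/
def gradNorm {m k : ℕ} (D : Matrix (Fin m) (Fin k) ℝ) : ℝ≥0 :=
  NNReal.sqrt (∑ i, ∑ j, ‖D i j‖₊ ^ 2)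

/-- `f : Ω → ℝᵐ` belongs to the Orlicz-Sobolev class `W^{1,φ}(Ω)`, and `Df` is (a representative
of) its distributional gradient: the components of `f` are in `W^{1,1}_loc(Ω)`, and
`∫_Ω φ(|∇f|) dm < ∞`. -/
structure MemOrliczSobolev {k m : ℕ} (φ : ℝ≥0 → ℝ≥0) (Ω : Set (EuclideanSpace ℝ (Fin k)))
    (f : EuclideanSpace ℝ (Fin k) → EuclideanSpace ℝ (Fin m))
    (Df : EuclideanSpace ℝ (Fin k) → Matrix (Fin m) (Fin k) ℝ) : Prop where
  weakDeriv : ∀ i j, IsWeakPartialDeriv Ω (fun x => f x i) (fun x => Df x i j) j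
  modular_lt_top : ∫⁻ x in Ω, (φ (gradNorm (Df x)) : ℝ≥0∞) < ⊤

/-- `∫_a^∞ (t / φ(t))^{1/(k-1)} dt`, with value `∞` of the integrand where `φ(t) = 0 < t`. -/
def calderonIntegral (k : ℕ) (φ : ℝ≥0 → ℝ≥0) (a : ℝ) : ℝ≥0∞ :=
  ∫⁻ t in Ioi a, (ENNReal.ofReal t / (φ t.toNNReal : ℝ≥0∞)) ^ (1 / ((k : ℝ) - 1))

/-- `A_* = (1 / φ(1))^{1/(k-1)} + ∫_1^∞ (t / φ(t))^{1/(k-1)} dt`. -/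
def aStar (k : ℕ) (φ : ℝ≥0 → ℝ≥0) : ℝ≥0∞ :=
  (1 / (φ 1 : ℝ≥0∞)) ^ (1 / ((k : ℝ) - 1)) + calderonIntegral k φ 1

/-- `φ_*(0) = 0`, `φ_*(t) = φ(1)` for `0 < t < 1`, and `φ_*(t) = φ(t)` for `t ≥ 1`. -/
def phiStar (φ : ℝ≥0 → ℝ≥0) (t : ℝ≥0) : ℝ≥0 :=
  if t = 0 then 0 else if t < 1 then φ 1 else φ t

/-- The closed cube with edges of length `l` parallel to the coordinate axes and with least
corner `a`. -/
def cube {k : ℕ} (a : EuclideanSpace ℝ (Fin k)) (l : ℝ) : Set (EuclideanSpace ℝ (Fin k)) :=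
  {x | ∀ i, a i ≤ x i ∧ x i ≤ a i + l}

/-- `α` is an admissible constant `α_k` in Calderon's inequality
`diam f(C) ≤ α A^{(k-1)/k} (∫_C φ(|∇f|) dm)^{1/k}`, `A = ∫_0^∞ (t / φ(t))^{1/(k-1)} dt`, for all
non-decreasing `φ` with `φ(0) = 0` and `A < ∞`, all domains `G` in `ℝᵏ`, all continuous real
functions `f` on `G` of the class `W^{1,φ}(G)` (written as maps to the Euclidean line `ℝ¹`), and
all cubes `C ⊆ G` with edges parallel to the axes. -/
def IsCalderonConstant (k : ℕ) (α : ℝ≥0) : Prop :=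
  ∀ φ : ℝ≥0 → ℝ≥0, Monotone φ → φ 0 = 0 → calderonIntegral k φ 0 < ⊤ →
  ∀ G : Set (EuclideanSpace ℝ (Fin k)), IsOpen G → IsConnected G →
  ∀ (f : EuclideanSpace ℝ (Fin k) → EuclideanSpace ℝ (Fin 1))
    (Df : EuclideanSpace ℝ (Fin k) → Matrix (Fin 1) (Fin k) ℝ),
    ContinuousOn f G → MemOrliczSobolev φ G f Df →
  ∀ (a : EuclideanSpace ℝ (Fin k)) (l : ℝ), 0 < l → cube a l ⊆ G →
    Metric.ediam (f '' cube a l) ≤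
      (α : ℝ≥0∞) * calderonIntegral k φ 0 ^ (((k : ℝ) - 1) / (k : ℝ)) *
        (∫⁻ x in cube a l, (φ (gradNorm (Df x)) : ℝ≥0∞)) ^ (1 / (k : ℝ))

end OrliczSobolev

end

/-!
**Existence of a Calderón constant.** For a `C¹` function `v` on a cube `C` of edge `l` and `x ∈ C`,
integrating along segments and substituting `z = x + t (y - x)` gives
`∫_C |v y - v x| dy ≤ diam C · ∫₀¹ t⁻ᵏ ∫_{C_t} |∇v| dz dt`, where `C_t` is the image of `C` under the
homothety with centre `x` and ratio `t`, a set of measure `(t l)ᵏ`. Hence only an upper bound for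
the integral of `|∇v|` over sets of given measure matters (`lintegral_enorm_sub_le`). If
`E_j = {2 ^ j ≤ |∇u| < 2 ^ (j + 1)}`, then `∫_S |∇u| ≤ ∑ 2 ^ (j + 1) min |E_j| |S|`
(`setLIntegral_le_tsum_min`), and this bound depends on `|S|` alone, so it survives averaging over
translations and therefore mollification (`setLIntegral_convolution_le`). As
`∫₀¹ t⁻ᵏ min |E_j| (t l)ᵏ dt ≤ 2 |E_j|^{1/k} l^{k-1}`, letting the mollifier shrink bounds the
oscillation of a continuous Sobolev function `u` on `C` by a multiple of `∑ 2 ^ j |E_j|^{1/k}`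
(`enorm_sub_le_tsum`), with no singular integral involved. Hölder's inequality for sums, with `2 ^ j`
written as `2 ^ j φ(2 ^ j)^{-1/k} · φ(2 ^ j)^{1/k}`, bounds this series by
`(∫₀^∞ (t / φ(t))^{1/(k-1)} dt)^{(k-1)/k} (∫ φ(|∇u|))^{1/k}` up to a constant factor
(`tsum_dyadicLevel_le`); only the monotonicity of `φ` is used.

**From a Calderón constant to Hausdorff measure.** The function `φ_*` is again non-decreasing, its
Calderón integral over `(0, ∞)` is at most `A_*`, and `φ_* ≤ φ + φ(1)`, so that `f` is of class
`W^{1,φ_*}` near each cube. Calderón's inequality for the components yields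
`(diam f(C))ᵏ ≤ (m α)ᵏ A_*^{k-1} ν(C)` for every cube `C ⊆ Ω`, with the locally finite measure
`dν = φ_*(|∇f|) dm` (`ediam_image_cube_pow_le`). Subdividing dyadic cubes turns this into
`H^k(f(Q)) ≤ K ν(Q)`, first for dyadic cubes, then for open sets, and by outer regularity of `ν` for
all `E ⊆ Ω` (`hausdorffMeasure_image_le`). If `m(E) = 0`, or if `∇f = 0` a.e. on `E`, then
`ν(E) = 0` because `φ_*(0) = 0`.
-/

noncomputable section

namespace OrliczSobolev

open Filter Topology

/-! ### The function `φ_*` -/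

theorem phiStar_monotone {φ : ℝ≥0 → ℝ≥0} (hφ : Monotone φ) : Monotone (phiStar φ) := by
  intro s t hst
  unfold phiStar
  split_ifs with h1 h2 h3 h4 h5 h6 h7
  all_goals first
    | exact le_rfl
    | exact zero_le
    | exact hφ (by order)
    | (exfalso; subst_vars; simp_all)

@[simp]
theorem phiStar_zero (φ : ℝ≥0 → ℝ≥0) : phiStar φ 0 = 0 := by simp [phiStar]

/-- This makes `φ_*(|∇f|)` integrable over bounded sets. -/
theorem phiStar_le (φ : ℝ≥0 → ℝ≥0) (t : ℝ≥0) : phiStar φ t ≤ φ t + φ 1 := by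
  unfold phiStar
  split_ifs <;> simp

/-- On `(0, 1]` the integrand is at most `(1 / φ 1) ^ (1 / (k - 1))`, and on `(1, ∞)` it is unchanged. -/
theorem calderonIntegral_phiStar_le {k : ℕ} (hk : 2 ≤ k) (φ : ℝ≥0 → ℝ≥0) :
    calderonIntegral k (phiStar φ) 0 ≤ aStar k φ := by
  have hk' : (2 : ℝ) ≤ k := by exact_mod_cast hk
  have hq : 0 ≤ 1 / ((k : ℝ) - 1) := by
    apply div_nonneg zero_le_one; linarith
  unfold calderonIntegral aStar calderonIntegral
  rw [← Ioc_union_Ioi_eq_Ioi (zero_le_one (α := ℝ))]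
  refine (lintegral_union_le _ _ _).trans (add_le_add ?_ ?_)
  · calc _ ≤ ∫⁻ _ in Ioc (0 : ℝ) 1, (1 / (φ 1 : ℝ≥0∞)) ^ (1 / ((k : ℝ) - 1)) := by
          refine setLIntegral_mono' measurableSet_Ioc fun t ht => ?_
          refine ENNReal.rpow_le_rpow ?_ hq
          have h0 : t.toNNReal ≠ 0 := (Real.toNNReal_pos.2 ht.1).ne'
          have h1 : phiStar φ t.toNNReal = φ 1 := by
            unfold phiStar
            rw [if_neg h0]
            split_ifs with h
            · rfl
            · congr 1
              exact le_antisymm (by simpa using ht.2) (not_lt.1 h)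
          rw [h1]
          gcongr
          simpa using ht.2
      _ = _ := by simp
  · refine setLIntegral_mono' measurableSet_Ioi fun t ht => ?_
    have h1 : 1 < t.toNNReal := by simpa using ht
    rw [show phiStar φ t.toNNReal = φ t.toNNReal by
      unfold phiStar
      rw [if_neg (by positivity), if_neg h1.not_gt]]

theorem aStar_ne_top {k : ℕ} (hk : 2 ≤ k) {φ : ℝ≥0 → ℝ≥0} (h1 : 0 < φ 1)
    (hA : calderonIntegral k φ 1 < ⊤) : aStar k φ ≠ ⊤ := by
  have hk' : (2 : ℝ) ≤ k := by exact_mod_cast hk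
  refine ENNReal.add_ne_top.2 ⟨ENNReal.rpow_ne_top_of_nonneg ?_ ?_, hA.ne⟩
  · apply div_nonneg zero_le_one; linarith
  · exact ENNReal.div_ne_top ENNReal.one_ne_top (by exact_mod_cast h1.ne')

/-! ### Gradients and coordinates -/

theorem gradNorm_row_le {m k : ℕ} (D : Matrix (Fin m) (Fin k) ℝ) (i : Fin m) :
    gradNorm (Matrix.of fun (_ : Fin 1) j => D i j) ≤ gradNorm D := by
  unfold gradNorm
  gcongr
  simpa using Finset.single_le_sum (f := fun i => ∑ j, ‖D i j‖₊ ^ 2) (fun _ _ => zero_le)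
    (Finset.mem_univ i)

theorem gradNorm_eq_zero {m k : ℕ} {D : Matrix (Fin m) (Fin k) ℝ} (h : D = 0) :
    gradNorm D = 0 := by
  simp [gradNorm, h]

theorem IsWeakPartialDeriv.mono {k : ℕ} {Ω G : Set (EuclideanSpace ℝ (Fin k))}
    {u g : EuclideanSpace ℝ (Fin k) → ℝ} {j : Fin k} (h : IsWeakPartialDeriv Ω u g j)
    (hΩ : IsOpen Ω) (hGΩ : G ⊆ Ω) : IsWeakPartialDeriv G u g j := by
  refine ⟨h.1.mono_set hGΩ, h.2.1.mono_set hGΩ, fun ψ hψ hc hs => ?_⟩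
  have h0 : ∀ x ∉ G, ψ x = 0 := fun x hx => image_eq_zero_of_notMem_tsupport fun hx' => hx (hs hx')
  have h1 : ∀ x ∉ G, fderiv ℝ ψ x = 0 := fun x hx =>
    fderiv_of_notMem_tsupport (𝕜 := ℝ) fun hx' => hx (hs hx')
  rw [← setIntegral_eq_of_subset_of_forall_sdiff_eq_zero hΩ.measurableSet hGΩ
      (fun x hx => by simp [h1 x hx.2]), h.2.2 ψ hψ hc (hs.trans hGΩ),
    ← setIntegral_eq_of_subset_of_forall_sdiff_eq_zero hΩ.measurableSet hGΩ
      (fun x hx => by simp [h0 x hx.2])]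

/-- On a part of finite measure, each component of a map of class `W^{1,φ}` is of class
`W^{1,φ_*}`. -/
theorem MemOrliczSobolev.component {k m : ℕ} {φ : ℝ≥0 → ℝ≥0} (hφ : Monotone φ)
    {Ω G : Set (EuclideanSpace ℝ (Fin k))}
    {f : EuclideanSpace ℝ (Fin k) → EuclideanSpace ℝ (Fin m)}
    {Df : EuclideanSpace ℝ (Fin k) → Matrix (Fin m) (Fin k) ℝ}
    (h : MemOrliczSobolev φ Ω f Df) (hΩ : IsOpen Ω) (hGΩ : G ⊆ Ω) (hvol : volume G < ⊤)
    (i : Fin m) :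
    MemOrliczSobolev (phiStar φ) G (fun x => WithLp.toLp 2 fun _ : Fin 1 => f x i)
      (fun x => Matrix.of fun _ j => Df x i j) := by
  refine ⟨fun _ j => by simpa using (h.weakDeriv i j).mono hΩ hGΩ, ?_⟩
  calc _ ≤ ∫⁻ x in G, ((φ (gradNorm (Df x)) : ℝ≥0∞) + φ 1) := by
        refine lintegral_mono fun x => ?_
        rw [← ENNReal.coe_add, ENNReal.coe_le_coe]
        exact (phiStar_monotone hφ (gradNorm_row_le (Df x) i)).trans (phiStar_le _ _)
    _ = (∫⁻ x in G, (φ (gradNorm (Df x)) : ℝ≥0∞)) + φ 1 * volume G := by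
        rw [lintegral_add_right _ measurable_const]; simp
    _ < ⊤ := ENNReal.add_lt_top.2
        ⟨(lintegral_mono_set hGΩ).trans_lt h.modular_lt_top, ENNReal.mul_lt_top ENNReal.coe_lt_top hvol⟩

theorem ediam_image_le_of_component {X : Type*} {m : ℕ} {f : X → EuclideanSpace ℝ (Fin m)}
    {s : Set X} {B : ℝ≥0∞}
    (h : ∀ i, Metric.ediam ((fun x => WithLp.toLp 2 fun _ : Fin 1 => f x i) '' s) ≤ B) :
    Metric.ediam (f '' s) ≤ m * B := by
  refine Metric.ediam_le ?_
  rintro _ ⟨x, hx, rfl⟩ _ ⟨y, hy, rfl⟩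
  have hc : ∀ i, edist (f x i) (f y i) ≤ B := fun i => by
    refine le_trans ?_ ((Metric.edist_le_ediam_of_mem (mem_image_of_mem _ hx)
      (mem_image_of_mem _ hy)).trans (h i))
    rw [EuclideanSpace.edist_eq, Fin.sum_univ_one, ← ENNReal.rpow_natCast, ← ENNReal.rpow_mul]
    norm_num
  rw [EuclideanSpace.edist_eq]
  calc _ ≤ (((m : ℝ≥0∞) * B) ^ 2) ^ (1 / 2 : ℝ) := by
        refine ENNReal.rpow_le_rpow ?_ (by norm_num)
        calc _ ≤ ∑ _i : Fin m, B ^ 2 := Finset.sum_le_sum fun i _ => by gcongr; exact hc i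
          _ = m * B ^ 2 := by simp
          _ ≤ _ := by
            rw [mul_pow]
            gcongr
            exact_mod_cast Nat.le_self_pow two_ne_zero m
    _ = _ := by
        rw [← ENNReal.rpow_natCast, ← ENNReal.rpow_mul]
        norm_num

/-! ### Cubes -/

theorem cube_eq_preimage {k : ℕ} (a : EuclideanSpace ℝ (Fin k)) (l : ℝ) :
    cube a l = (MeasurableEquiv.toLp 2 (Fin k → ℝ)).symm ⁻¹'
      Icc (fun i => a i) (fun i => a i + l) := by
  ext x
  simp [cube, Pi.le_def, forall_and]

theorem isClosed_cube {k : ℕ} (a : EuclideanSpace ℝ (Fin k)) (l : ℝ) : IsClosed (cube a l) := by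
  simp only [cube, ofPred_forall]
  refine isClosed_iInter fun i => IsClosed.and ?_ ?_
  · exact isClosed_le (by fun_prop) (by fun_prop)
  · exact isClosed_le (by fun_prop) (by fun_prop)

theorem convex_cube {k : ℕ} (a : EuclideanSpace ℝ (Fin k)) (l : ℝ) : Convex ℝ (cube a l) := by
  intro x hx y hy s t hs ht hst i
  have h1 := hx i
  have h2 := hy i
  simp only [PiLp.add_apply, PiLp.smul_apply, smul_eq_mul]
  obtain rfl : t = 1 - s := by linarith
  constructor <;> nlinarith

theorem dist_le_of_mem_cube {k : ℕ} {a x y : EuclideanSpace ℝ (Fin k)} {l : ℝ}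
    (hl : 0 ≤ l) (hx : x ∈ cube a l) (hy : y ∈ cube a l) : dist x y ≤ k * l := by
  rw [EuclideanSpace.dist_eq, Real.sqrt_le_iff]
  refine ⟨by positivity, ?_⟩
  calc ∑ i, dist (x i) (y i) ^ 2 ≤ ∑ _i : Fin k, l ^ 2 := by
        refine Finset.sum_le_sum fun i _ => ?_
        gcongr
        rw [Real.dist_eq, abs_le]
        have h1 := hx i
        have h2 := hy i
        constructor <;> linarith
    _ = k * l ^ 2 := by simp
    _ ≤ (k * l) ^ 2 := by
        rw [mul_pow]
        gcongr
        exact_mod_cast Nat.le_self_pow two_ne_zero k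

theorem isCompact_cube {k : ℕ} (a : EuclideanSpace ℝ (Fin k)) {l : ℝ} (hl : 0 ≤ l) :
    IsCompact (cube a l) := by
  refine Metric.isCompact_of_isClosed_isBounded (isClosed_cube a l) ?_
  exact Metric.isBounded_iff.2 ⟨k * l, fun x hx y hy => dist_le_of_mem_cube hl hx hy⟩

theorem volume_cube {k : ℕ} (a : EuclideanSpace ℝ (Fin k)) {l : ℝ} (hl : 0 ≤ l) :
    volume (cube a l) = ENNReal.ofReal (l ^ k) := by
  rw [cube_eq_preimage, (EuclideanSpace.volume_preserving_symm_measurableEquiv_toLp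
    (Fin k)).measure_preimage_equiv, Real.volume_Icc_pi]
  simp [ENNReal.ofReal_pow hl]

/-- The half-open dyadic cube of generation `n` with index `z`. -/
def dyadicCube {k : ℕ} (n : ℕ) (z : Fin k → ℤ) : Set (EuclideanSpace ℝ (Fin k)) :=
  {x | ∀ i, ⌊2 ^ n * x i⌋ = z i}

/-- The closure of `dyadicCube n z`. -/
def closedDyadicCube {k : ℕ} (n : ℕ) (z : Fin k → ℤ) : Set (EuclideanSpace ℝ (Fin k)) :=
  cube (WithLp.toLp 2 fun i => z i / 2 ^ n) (1 / 2 ^ n)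

/-- The index of the dyadic cube of generation `n` that contains `x`. -/
def dyadicIndex {k : ℕ} (n : ℕ) (x : EuclideanSpace ℝ (Fin k)) : Fin k → ℤ :=
  fun i => ⌊2 ^ n * x i⌋

theorem mem_dyadicCube {k : ℕ} {n : ℕ} {z : Fin k → ℤ} {x : EuclideanSpace ℝ (Fin k)} :
    x ∈ dyadicCube n z ↔ dyadicIndex n x = z := by
  simp [dyadicCube, dyadicIndex, funext_iff]

theorem mem_closedDyadicCube {k : ℕ} {n : ℕ} {z : Fin k → ℤ} {x : EuclideanSpace ℝ (Fin k)} :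
    x ∈ closedDyadicCube n z ↔ ∀ i, z i ≤ 2 ^ n * x i ∧ 2 ^ n * x i ≤ z i + 1 := by
  have h2 : (0 : ℝ) < 2 ^ n := by positivity
  refine forall_congr' fun i => ?_
  simp only
  rw [← add_div, div_le_iff₀ h2, le_div_iff₀ h2, mul_comm]

theorem dyadicCube_subset {k : ℕ} (n : ℕ) (z : Fin k → ℤ) :
    dyadicCube n z ⊆ closedDyadicCube n z := by
  intro x hx
  refine mem_closedDyadicCube.2 fun i => ?_
  rw [← hx i]
  exact ⟨Int.floor_le _, (Int.lt_floor_add_one _).le⟩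

theorem dyadicCube_ae_eq {k : ℕ} (n : ℕ) (z : Fin k → ℤ) :
    dyadicCube n z =ᵐ[volume] closedDyadicCube n z := by
  have h2 : (0 : ℝ) < 2 ^ n := by positivity
  have h : dyadicCube n z = (MeasurableEquiv.toLp 2 (Fin k → ℝ)).symm ⁻¹'
      (univ.pi fun i => Ico (z i / 2 ^ n : ℝ) (z i / 2 ^ n + 1 / 2 ^ n)) := by
    ext x
    simp only [dyadicCube, mem_ofPred_eq, Int.floor_eq_iff, mem_preimage, mem_univ_pi, mem_Ico]
    refine forall_congr' fun i => ?_
    rw [← add_div, div_le_iff₀ h2, lt_div_iff₀ h2, mul_comm]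
    rfl
  rw [h, closedDyadicCube, cube_eq_preimage]
  exact (EuclideanSpace.volume_preserving_symm_measurableEquiv_toLp
    (Fin k)).quasiMeasurePreserving.preimage_ae_eq Measure.univ_pi_Ico_ae_eq_Icc

theorem measurableSet_dyadicCube {k : ℕ} (n : ℕ) (z : Fin k → ℤ) :
    MeasurableSet (dyadicCube n z) := by
  simp only [dyadicCube, ofPred_forall]
  refine MeasurableSet.iInter fun i => ?_
  exact measurableSet_eq_fun (by fun_prop) measurable_const

theorem pairwise_disjoint_dyadicCube {k : ℕ} (n : ℕ) :
    Pairwise fun z w : Fin k → ℤ => Disjoint (dyadicCube n z) (dyadicCube n w) := by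
  intro z w hzw
  refine disjoint_left.2 fun x hx hy => hzw ?_
  rw [← mem_dyadicCube.1 hx, mem_dyadicCube.1 hy]

theorem antitone_closedDyadicCube {k : ℕ} (x : EuclideanSpace ℝ (Fin k)) :
    Antitone fun n => closedDyadicCube n (dyadicIndex n x) := by
  refine antitone_nat_of_succ_le fun n y hy => ?_
  refine mem_closedDyadicCube.2 fun i => ?_
  have h := mem_closedDyadicCube.1 hy i
  simp only [dyadicIndex] at h ⊢
  set a := 2 ^ n * x i
  rw [show 2 ^ (n + 1) * x i = 2 * a by simp only [a]; ring,
    show 2 ^ (n + 1) * y i = 2 * (2 ^ n * y i) by ring] at h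
  have h1 : 2 * ⌊a⌋ ≤ ⌊2 * a⌋ := by
    rw [Int.le_floor]; push_cast; linarith [Int.floor_le a]
  have h2 : ⌊2 * a⌋ + 1 ≤ 2 * ⌊a⌋ + 2 := by
    have : ⌊2 * a⌋ < 2 * ⌊a⌋ + 2 := by
      rw [Int.floor_lt]; push_cast; linarith [Int.lt_floor_add_one a]
    omega
  have h1' : (2 : ℝ) * ⌊a⌋ ≤ ⌊2 * a⌋ := by exact_mod_cast h1
  have h2' : (⌊2 * a⌋ : ℝ) + 1 ≤ 2 * ⌊a⌋ + 2 := by exact_mod_cast h2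
  constructor <;> linarith

/-! ### From diameters of images of cubes to Hausdorff measures -/

section Hausdorff

variable {k m : ℕ} {f : EuclideanSpace ℝ (Fin k) → EuclideanSpace ℝ (Fin m)}
  {Ω : Set (EuclideanSpace ℝ (Fin k))} {ν : Measure (EuclideanSpace ℝ (Fin k))} {K : ℝ≥0∞}

/-- The dyadic subcubes of later generations form coverings of fine images, by uniform continuity. -/
theorem hausdorffMeasure_image_dyadicCube_le (hf : ContinuousOn f Ω) (hν : ν ≪ volume)
    (hdiam : ∀ a l, 0 < l → cube a l ⊆ Ω → Metric.ediam (f '' cube a l) ^ k ≤ K * ν (cube a l))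
    {n : ℕ} {z : Fin k → ℤ} (hz : closedDyadicCube n z ⊆ Ω) :
    Measure.hausdorffMeasure (k : ℝ) (f '' dyadicCube n z) ≤ K * ν (dyadicCube n z) := by
  set Q := dyadicCube n z
  -- a cube of a later generation that meets `Q` lies in `Q`
  have hsub : ∀ N, n ≤ N → ∀ w, (dyadicCube N w ∩ Q).Nonempty →
      closedDyadicCube N w ⊆ closedDyadicCube n z := by
    rintro N hN w ⟨x, hx, hxQ⟩
    rw [← mem_dyadicCube.1 hx, ← mem_dyadicCube.1 hxQ]
    exact antitone_closedDyadicCube x hN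
  let r : ℕ → ℝ≥0∞ := fun N => ⨆ w : {w : Fin k → ℤ // (dyadicCube N w ∩ Q).Nonempty},
    Metric.ediam (f '' closedDyadicCube N w.1)
  have hr : Tendsto r atTop (𝓝 0) := by
    rw [ENNReal.tendsto_nhds_zero]
    intro ε hε
    have huc := (isCompact_cube (WithLp.toLp 2 fun i => (z i : ℝ) / 2 ^ n)
      (by positivity : (0 : ℝ) ≤ 1 / 2 ^ n)).uniformContinuousOn_of_continuous (hf.mono hz)
    obtain ⟨δ, hδ, hδ'⟩ := EMetric.uniformContinuousOn_iff.1 huc ε hε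
    have hlim : Tendsto (fun N : ℕ => ENNReal.ofReal ((k : ℝ) * (1 / 2 ^ N))) atTop (𝓝 0) := by
      have h1 : Tendsto (fun N : ℕ => (k : ℝ) * (1 / 2) ^ N) atTop (𝓝 (k * 0)) :=
        (tendsto_pow_atTop_nhds_zero_of_lt_one (by norm_num) (by norm_num)).const_mul _
      simpa using ENNReal.tendsto_ofReal h1
    filter_upwards [eventually_ge_atTop n, hlim.eventually_lt_const hδ] with N hN hNδ
    refine iSup_le fun w => Metric.ediam_le ?_
    rintro _ ⟨x, hx, rfl⟩ _ ⟨y, hy, rfl⟩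
    refine (hδ' (hsub N hN w.1 w.2 hx) (hsub N hN w.1 w.2 hy) (lt_of_le_of_lt ?_ hNδ)).le
    rw [edist_dist]
    exact ENNReal.ofReal_le_ofReal (dist_le_of_mem_cube (by positivity) hx hy)
  refine (Measure.hausdorffMeasure_le_liminf_tsum (k : ℝ) (f '' Q) r hr
    (fun N (w : Fin k → ℤ) => f '' (dyadicCube N w ∩ Q)) ?_ ?_).trans ?_
  · refine Eventually.of_forall fun N w => ?_
    rcases (dyadicCube N w ∩ Q).eq_empty_or_nonempty with h | h
    · simp [h]
    · exact (Metric.ediam_mono (image_mono (inter_subset_left.trans (dyadicCube_subset N w)))).trans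
        (le_iSup (fun w : {w : Fin k → ℤ // (dyadicCube N w ∩ Q).Nonempty} =>
          Metric.ediam (f '' closedDyadicCube N w.1)) ⟨w, h⟩)
  · refine Eventually.of_forall fun N => ?_
    rintro _ ⟨x, hx, rfl⟩
    exact mem_iUnion.2 ⟨dyadicIndex N x, mem_image_of_mem _ ⟨mem_dyadicCube.2 rfl, hx⟩⟩
  · refine (liminf_le_liminf (v := fun _ => K * ν Q) ?_).trans (by simp)
    filter_upwards [eventually_ge_atTop n] with N hN
    calc ∑' w, Metric.ediam (f '' (dyadicCube N w ∩ Q)) ^ (k : ℝ)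
        ≤ ∑' w, K * ν (dyadicCube N w ∩ Q) := by
          refine ENNReal.tsum_le_tsum fun w => ?_
          rw [ENNReal.rpow_natCast]
          rcases (dyadicCube N w ∩ Q).eq_empty_or_nonempty with h | h
          · rw [h]
            rcases Nat.eq_zero_or_pos k with rfl | hk
            · -- `∅` has diameter `0`, and `0 ^ 0 = 1`; but in dimension `0` every dyadic cube is the
              -- whole space, so the intersection is not empty
              exfalso
              have h0 : (0 : EuclideanSpace ℝ (Fin 0)) ∈ dyadicCube N w ∩ Q :=
                ⟨fun i => i.elim0, fun i => i.elim0⟩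
              simp [h] at h0
            · simp [hk.ne']
          · have h1 : ν (dyadicCube N w ∩ Q) = ν (closedDyadicCube N w) := by
              have h2 : dyadicCube N w ⊆ Q := by
                obtain ⟨x, hx, hxQ⟩ := h
                intro y hy
                have hNn : ∀ i, ⌊2 ^ n * y i⌋ = ⌊2 ^ n * x i⌋ := fun i => by
                  have e := (hy i).trans (hx i).symm
                  obtain ⟨d, rfl⟩ := Nat.exists_eq_add_of_le hN
                  have key : ∀ t : ℝ, ⌊2 ^ n * t⌋ = ⌊2 ^ (n + d) * t⌋ / (2 ^ d : ℕ) := fun t => by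
                    rw [← Int.floor_div_natCast]
                    congr 1
                    push_cast
                    rw [pow_add]
                    field_simp
                  rw [key, key, e]
                exact fun i => (hNn i).trans (hxQ i)
              rw [inter_eq_left.2 h2]
              exact measure_congr (hν.ae_eq (dyadicCube_ae_eq N w))
            rw [h1]
            refine le_trans ?_ (hdiam _ _ (by positivity) ((hsub N hN w h).trans hz))
            gcongr
            exact inter_subset_left.trans (dyadicCube_subset N w)
      _ = K * ν Q := by
          rw [ENNReal.tsum_mul_left, ← measure_iUnion]
          · congr 2
            rw [← iUnion_inter, inter_eq_right]
            exact fun x _ => mem_iUnion.2 ⟨dyadicIndex N x, mem_dyadicCube.2 rfl⟩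
          · exact fun z w hzw => (pairwise_disjoint_dyadicCube N hzw).mono inter_subset_left
              inter_subset_left
          · exact fun w => (measurableSet_dyadicCube N w).inter (measurableSet_dyadicCube n z)

/-- An open set is the increasing union of the dyadic cubes of generation `n` whose closures it
contains, and measures of images are continuous along increasing unions. -/
theorem hausdorffMeasure_image_isOpen_le (hf : ContinuousOn f Ω) (hν : ν ≪ volume)
    (hdiam : ∀ a l, 0 < l → cube a l ⊆ Ω → Metric.ediam (f '' cube a l) ^ k ≤ K * ν (cube a l))
    {U : Set (EuclideanSpace ℝ (Fin k))} (hU : IsOpen U) (hUΩ : U ⊆ Ω) :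
    Measure.hausdorffMeasure (k : ℝ) (f '' U) ≤ K * ν U := by
  let V : ℕ → Set (EuclideanSpace ℝ (Fin k)) :=
    fun n => {x | closedDyadicCube n (dyadicIndex n x) ⊆ U}
  have hmono : Monotone V := fun n N hN x hx => (antitone_closedDyadicCube x hN).trans hx
  have hself : ∀ n (x : EuclideanSpace ℝ (Fin k)), x ∈ closedDyadicCube n (dyadicIndex n x) :=
    fun n x => dyadicCube_subset _ _ (mem_dyadicCube.2 rfl)
  have hVU : ∀ n, V n ⊆ U := fun n x hx => hx (hself n x)
  have hUV : U ⊆ ⋃ n, V n := by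
    intro x hx
    obtain ⟨δ, hδ, hb⟩ := Metric.isOpen_iff.1 hU x hx
    have h1 : Tendsto (fun N : ℕ => (k : ℝ) * (1 / 2) ^ N) atTop (𝓝 (k * 0)) :=
      (tendsto_pow_atTop_nhds_zero_of_lt_one (by norm_num) (by norm_num)).const_mul _
    rw [mul_zero] at h1
    obtain ⟨N, hN⟩ := (h1.eventually_lt_const hδ).exists
    refine mem_iUnion.2 ⟨N, fun y hy => hb (lt_of_le_of_lt ?_ hN)⟩
    simpa using dist_le_of_mem_cube (by positivity) hy (hself N x)
  have hV : ∀ n, Measure.hausdorffMeasure (k : ℝ) (f '' V n) ≤ K * ν U := by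
    intro n
    let I := {z : Fin k → ℤ // closedDyadicCube n z ⊆ U}
    calc _ ≤ Measure.hausdorffMeasure (k : ℝ) (⋃ z : I, f '' dyadicCube n z.1) := by
          refine measure_mono ?_
          rintro _ ⟨x, hx, rfl⟩
          exact mem_iUnion.2 ⟨⟨dyadicIndex n x, hx⟩, mem_image_of_mem _ (mem_dyadicCube.2 rfl)⟩
      _ ≤ ∑' z : I, K * ν (dyadicCube n z.1) := (measure_iUnion_le _).trans <|
          ENNReal.tsum_le_tsum fun z =>
            hausdorffMeasure_image_dyadicCube_le hf hν hdiam (z.2.trans hUΩ)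
      _ = K * ν (⋃ z : I, dyadicCube n z.1) := by
          rw [ENNReal.tsum_mul_left, ← measure_iUnion]
          · exact fun z w hzw => pairwise_disjoint_dyadicCube n fun h => hzw (Subtype.ext h)
          · exact fun w => measurableSet_dyadicCube n _
      _ ≤ K * ν U := by
          gcongr
          exact iUnion_subset fun z => (dyadicCube_subset n z.1).trans z.2
  calc _ ≤ Measure.hausdorffMeasure (k : ℝ) (⋃ n, f '' V n) := by
        rw [← image_iUnion]; exact measure_mono (image_mono hUV)
    _ = ⨆ n, Measure.hausdorffMeasure (k : ℝ) (f '' V n) :=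
        Monotone.measure_iUnion fun n N hN => image_mono (hmono hN)
    _ ≤ _ := iSup_le hV

/-- If a continuous map does not enlarge cubes by more than a locally finite, absolutely continuous
measure allows, then the same bound holds for the Hausdorff measure of the image of any set. -/
theorem hausdorffMeasure_image_le [IsLocallyFiniteMeasure ν] (hf : ContinuousOn f Ω)
    (hΩ : IsOpen Ω) (hν : ν ≪ volume) (hK : K ≠ ⊤)
    (hdiam : ∀ a l, 0 < l → cube a l ⊆ Ω → Metric.ediam (f '' cube a l) ^ k ≤ K * ν (cube a l))
    {E : Set (EuclideanSpace ℝ (Fin k))} (hE : E ⊆ Ω) :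
    Measure.hausdorffMeasure (k : ℝ) (f '' E) ≤ K * ν E := by
  have key : ∀ r, ν E < r → Measure.hausdorffMeasure (k : ℝ) (f '' E) ≤ K * r := fun r hr => by
    obtain ⟨U, hEU, hU, hUr⟩ := E.exists_isOpen_lt_of_lt r hr
    calc _ ≤ Measure.hausdorffMeasure (k : ℝ) (f '' (U ∩ Ω)) :=
          measure_mono (image_mono (subset_inter hEU hE))
      _ ≤ K * ν (U ∩ Ω) :=
          hausdorffMeasure_image_isOpen_le hf hν hdiam (hU.inter hΩ) inter_subset_right
      _ ≤ K * r := by gcongr; exact (measure_mono inter_subset_left).trans hUr.le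
  rcases eq_or_ne K 0 with rfl | hK0
  · simpa using hausdorffMeasure_image_isOpen_le hf hν hdiam hΩ subset_rfl |>.trans'
      (measure_mono (image_mono hE))
  · rw [mul_comm, ← ENNReal.div_le_iff_le_mul (.inl hK0) (.inl hK)]
    refine le_of_forall_gt_imp_ge_of_dense fun r hr => ?_
    rw [ENNReal.div_le_iff_le_mul (.inl hK0) (.inl hK), mul_comm]
    exact key r hr

end Hausdorff

/-- Calderón's inequality for the components, with `φ_*` in place of `φ`, gives the bound for the
diameter of the image of a cube. -/
theorem ediam_image_cube_pow_le {k : ℕ} (hk : 2 ≤ k) {α : ℝ≥0} (hα : IsCalderonConstant k α)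
    {m : ℕ} {φ : ℝ≥0 → ℝ≥0} (hφ : Monotone φ) (h1 : 0 < φ 1) (hA : calderonIntegral k φ 1 < ⊤)
    {Ω : Set (EuclideanSpace ℝ (Fin k))} (hΩ : IsOpen Ω)
    {f : EuclideanSpace ℝ (Fin k) → EuclideanSpace ℝ (Fin m)}
    {Df : EuclideanSpace ℝ (Fin k) → Matrix (Fin m) (Fin k) ℝ}
    (hf : ContinuousOn f Ω) (hW : MemOrliczSobolev φ Ω f Df)
    {a : EuclideanSpace ℝ (Fin k)} {l : ℝ} (hl : 0 < l) (hC : cube a l ⊆ Ω) :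
    Metric.ediam (f '' cube a l) ^ k ≤
      ((m : ℝ≥0∞) * (α : ℝ≥0∞)) ^ k * aStar k φ ^ (k - 1) *
        ∫⁻ x in cube a l, (phiStar φ (gradNorm (Df x)) : ℝ≥0∞) := by
  have hk' : (2 : ℝ) ≤ k := by exact_mod_cast hk
  have hcp := isCompact_cube a hl.le
  obtain ⟨δ, hδ, hδΩ⟩ := hcp.exists_thickening_subset_open hΩ hC
  set G := Metric.thickening δ (cube a l)
  have hCG : cube a l ⊆ G := Metric.self_subset_thickening hδ _
  have hGc : IsConnected G :=
    ⟨⟨a, hCG fun i => ⟨le_rfl, by linarith⟩⟩, ((convex_cube a l).thickening δ).isPreconnected⟩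
  have hGv : volume G < ⊤ := (hcp.isBounded.thickening).measure_lt_top
  set I := ∫⁻ x in cube a l, (phiStar φ (gradNorm (Df x)) : ℝ≥0∞)
  have hcomp : ∀ i, Metric.ediam ((fun x => WithLp.toLp 2 fun _ : Fin 1 => f x i) '' cube a l) ≤
      α * aStar k φ ^ (((k : ℝ) - 1) / k) * I ^ (1 / (k : ℝ)) := fun i => by
    refine (hα (phiStar φ) (phiStar_monotone hφ) (phiStar_zero φ)
      ((calderonIntegral_phiStar_le hk φ).trans_lt (aStar_ne_top hk h1 hA).lt_top) G
      Metric.isOpen_thickening hGc _ _ ?_ (hW.component hφ hΩ hδΩ hGv i) a l hl hCG).trans ?_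
    · have := hf.mono hδΩ
      fun_prop
    · gcongr
      · exact div_nonneg (by linarith) (by linarith)
      · exact calderonIntegral_phiStar_le hk φ
      · exact lintegral_mono fun x =>
          ENNReal.coe_le_coe.2 (phiStar_monotone hφ (gradNorm_row_le (Df x) i))
  calc _ ≤ ((m : ℝ≥0∞) * (α * aStar k φ ^ (((k : ℝ) - 1) / k) * I ^ (1 / (k : ℝ)))) ^ k := by
        gcongr
        exact ediam_image_le_of_component hcomp
    _ = _ := by
        have e1 : (aStar k φ ^ (((k : ℝ) - 1) / k)) ^ k = aStar k φ ^ (k - 1) := by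
          rw [← ENNReal.rpow_natCast, ← ENNReal.rpow_mul, div_mul_cancel₀ _ (by linarith),
            ← ENNReal.rpow_natCast, Nat.cast_sub (by omega), Nat.cast_one]
        have e2 : (I ^ (1 / (k : ℝ))) ^ k = I := by
          rw [← ENNReal.rpow_natCast, ← ENNReal.rpow_mul, div_mul_cancel₀ _ (by linarith),
            ENNReal.rpow_one]
        rw [mul_pow, mul_pow, mul_pow, e1, e2]
        ring

/-- The measurability of `E` is not needed: the measure with density `φ_*(|∇f|)` is outer regular on
all sets. -/
theorem hausdorffMeasure_image_le_lintegral {k : ℕ} (hk : 2 ≤ k) {α : ℝ≥0}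
    (hα : IsCalderonConstant k α)
    {m : ℕ} {φ : ℝ≥0 → ℝ≥0} (hφ : Monotone φ) (h1 : 0 < φ 1) (hA : calderonIntegral k φ 1 < ⊤)
    {Ω : Set (EuclideanSpace ℝ (Fin k))} (hΩ : IsOpen Ω)
    {f : EuclideanSpace ℝ (Fin k) → EuclideanSpace ℝ (Fin m)}
    {Df : EuclideanSpace ℝ (Fin k) → Matrix (Fin m) (Fin k) ℝ}
    (hf : ContinuousOn f Ω) (hW : MemOrliczSobolev φ Ω f Df)
    {E : Set (EuclideanSpace ℝ (Fin k))} (hE : E ⊆ Ω) :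
    Measure.hausdorffMeasure (k : ℝ) (f '' E) ≤
      ((m : ℝ≥0∞) * (α : ℝ≥0∞)) ^ k * aStar k φ ^ (k - 1) *
        ∫⁻ x in E, (phiStar φ (gradNorm (Df x)) : ℝ≥0∞) := by
  let ν : Measure (EuclideanSpace ℝ (Fin k)) :=
    (volume.restrict Ω).withDensity fun x => (phiStar φ (gradNorm (Df x)) : ℝ≥0∞)
  have hνs : ∀ s, ν s = ∫⁻ x in s ∩ Ω, (phiStar φ (gradNorm (Df x)) : ℝ≥0∞) := fun s => by
    simp only [ν]
    rw [withDensity_apply', Measure.restrict_restrict' hΩ.measurableSet]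
  have hν : ∀ s ⊆ Ω, ν s = ∫⁻ x in s, (phiStar φ (gradNorm (Df x)) : ℝ≥0∞) := fun s hs => by
    rw [hνs, inter_eq_left.2 hs]
  have : IsLocallyFiniteMeasure ν := by
    refine ⟨fun x => ⟨Metric.ball x 1, Metric.ball_mem_nhds x one_pos, ?_⟩⟩
    rw [hνs]
    calc _ ≤ ∫⁻ x in Metric.ball x 1 ∩ Ω, ((φ (gradNorm (Df x)) : ℝ≥0∞) + φ 1) :=
          lintegral_mono fun x => by
            rw [← ENNReal.coe_add, ENNReal.coe_le_coe]
            exact phiStar_le _ _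
      _ = (∫⁻ x in Metric.ball x 1 ∩ Ω, (φ (gradNorm (Df x)) : ℝ≥0∞)) +
            φ 1 * volume (Metric.ball x 1 ∩ Ω) := by
          rw [lintegral_add_right _ measurable_const]; simp
      _ < ⊤ := ENNReal.add_lt_top.2
          ⟨(lintegral_mono_set inter_subset_right).trans_lt hW.modular_lt_top,
            ENNReal.mul_lt_top ENNReal.coe_lt_top
              ((measure_mono inter_subset_left).trans_lt measure_ball_lt_top)⟩
  rw [← hν E hE]
  refine hausdorffMeasure_image_le hf hΩ
    ((withDensity_absolutelyContinuous _ _).trans Measure.restrict_le_self.absolutelyContinuous)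
    ?_ (fun a l hl hC => ?_) hE
  · exact ENNReal.mul_ne_top (ENNReal.pow_ne_top (by finiteness))
      (ENNReal.pow_ne_top (aStar_ne_top hk h1 hA))
  · rw [hν _ hC]
    exact ediam_image_cube_pow_le hk hα hφ h1 hA hΩ hf hW hl hC

/-! ### A dyadic decomposition of the gradient -/

section Dyadic

variable {X : Type*} [MeasurableSpace X] {μ : Measure X}

/-- The set where `2 ^ j ≤ g < 2 ^ (j + 1)`. -/
def dyadicLevel (g : X → ℝ≥0) (j : ℤ) : Set X := g ⁻¹' Ico (2 ^ j) (2 ^ (j + 1))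

theorem measurableSet_dyadicLevel {g : X → ℝ≥0} (hg : Measurable g) (j : ℤ) :
    MeasurableSet (dyadicLevel g j) := hg measurableSet_Ico

theorem pairwise_disjoint_dyadicLevel {X : Type*} (g : X → ℝ≥0) :
    Pairwise fun i j => Disjoint (dyadicLevel g i) (dyadicLevel g j) := by
  intro i j hij
  have h := (zpow_right_mono₀ (one_le_two (α := ℝ≥0))).pairwise_disjoint_on_Ico_succ hij
  simp only [Order.succ_eq_add_one, Function.onFun] at h
  exact h.preimage g

/-- A bound for the integral over a set that depends on the measure of the set only. -/
theorem setLIntegral_le_tsum_min {g : X → ℝ≥0} (hg : Measurable g) (S : Set X) :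
    ∫⁻ x in S, g x ∂μ ≤
      ∑' j : ℤ, ((2 ^ (j + 1) : ℝ≥0) : ℝ≥0∞) * min (μ (dyadicLevel g j)) (μ S) := by
  calc ∫⁻ x in S, g x ∂μ
      ≤ ∫⁻ x in S, ∑' j : ℤ,
          (dyadicLevel g j).indicator (fun _ => ((2 ^ (j + 1) : ℝ≥0) : ℝ≥0∞)) x ∂μ := by
        refine lintegral_mono fun x => ?_
        rcases eq_or_ne (g x) 0 with h | h
        · simp [h]
        · obtain ⟨j, hj⟩ := exists_mem_Ico_zpow (pos_iff_ne_zero.2 h) one_lt_two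
          refine le_trans ?_ (ENNReal.le_tsum j)
          rw [indicator_of_mem (show x ∈ dyadicLevel g j from hj)]
          exact ENNReal.coe_le_coe.2 hj.2.le
    _ = ∑' j : ℤ, ((2 ^ (j + 1) : ℝ≥0) : ℝ≥0∞) * μ (dyadicLevel g j ∩ S) := by
        rw [lintegral_tsum fun j =>
          (measurable_const.indicator (measurableSet_dyadicLevel hg j)).aemeasurable]
        refine tsum_congr fun j => ?_
        rw [lintegral_indicator_const (measurableSet_dyadicLevel hg j),
          Measure.restrict_apply (measurableSet_dyadicLevel hg j)]
    _ ≤ _ := by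
        gcongr
        exact le_min (measure_mono inter_subset_left) (measure_mono inter_subset_right)

/-- A lower bound for one dyadic piece of the Calderón integral: on `(2 ^ (j - 1), 2 ^ j]` the integrand
is at least its value with `2 ^ (j - 1)` in the numerator and `φ (2 ^ j)` in the denominator. -/
theorem lintegral_Ioc_zpow_ge {k : ℕ} (hk : 2 ≤ k) {φ : ℝ≥0 → ℝ≥0} (hφ : Monotone φ) (j : ℤ) :
    ((2 ^ (j - 1) : ℝ≥0) : ℝ≥0∞) *
        (((2 ^ (j - 1) : ℝ≥0) : ℝ≥0∞) / (φ (2 ^ j) : ℝ≥0∞)) ^ (1 / ((k : ℝ) - 1)) ≤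
      ∫⁻ t in Ioc ((2 : ℝ) ^ (j - 1)) (2 ^ j),
        (ENNReal.ofReal t / (φ t.toNNReal : ℝ≥0∞)) ^ (1 / ((k : ℝ) - 1)) := by
  have hk' : (2 : ℝ) ≤ k := by exact_mod_cast hk
  have e : ENNReal.ofReal ((2 : ℝ) ^ (j - 1)) = ((2 ^ (j - 1) : ℝ≥0) : ℝ≥0∞) := by
    rw [ENNReal.ofReal, Real.toNNReal_of_nonneg (by positivity)]
    congr 1
  have hvol : volume (Ioc ((2 : ℝ) ^ (j - 1)) (2 ^ j)) = ((2 ^ (j - 1) : ℝ≥0) : ℝ≥0∞) := by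
    rw [Real.volume_Ioc, ← e]
    congr 1
    have : (2 : ℝ) ^ j = 2 ^ (j - 1) * 2 := by rw [← zpow_add_one₀ two_ne_zero]; simp
    rw [this]; ring
  rw [mul_comm]
  nth_rw 2 [← hvol]
  rw [← setLIntegral_const]
  refine setLIntegral_mono' measurableSet_Ioc fun t ht => ENNReal.rpow_le_rpow ?_ ?_
  · gcongr
    · rw [← e]; exact ENNReal.ofReal_le_ofReal ht.1.le
    · refine hφ (Real.toNNReal_le_iff_le_coe.2 ?_)
      simpa using ht.2
  · apply div_nonneg zero_le_one; linarith

/-- The sum on the left is comparable to the norm of `g` in the Lorentz space `L^{k,1}`. -/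
theorem tsum_dyadicLevel_le {k : ℕ} (hk : 2 ≤ k) {φ : ℝ≥0 → ℝ≥0} (hφ : Monotone φ)
    (hA : calderonIntegral k φ 0 < ⊤) {g : X → ℝ≥0} (hg : Measurable g) :
    ∑' j : ℤ, ((2 ^ (j - 1) : ℝ≥0) : ℝ≥0∞) * μ (dyadicLevel g j) ^ (1 / (k : ℝ)) ≤
      calderonIntegral k φ 0 ^ (((k : ℝ) - 1) / k) * (∫⁻ x, φ (g x) ∂μ) ^ (1 / (k : ℝ)) := by
  have hk' : (2 : ℝ) ≤ k := by exact_mod_cast hk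
  have hk0 : (k : ℝ) ≠ 0 := by linarith
  have hk1 : (k : ℝ) - 1 ≠ 0 := by linarith
  set q := 1 / ((k : ℝ) - 1) with hq
  have hq0 : 0 < q := by rw [hq]; apply div_pos one_pos; linarith
  have hIoc : ∑' j : ℤ, ∫⁻ t in Ioc ((2 : ℝ) ^ (j - 1)) (2 ^ j),
      (ENNReal.ofReal t / (φ t.toNNReal : ℝ≥0∞)) ^ q ≤ calderonIntegral k φ 0 := by
    rw [← lintegral_iUnion (fun j => measurableSet_Ioc)]
    · refine lintegral_mono_set (iUnion_subset fun j t ht => ?_)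
      exact lt_trans (by positivity) ht.1
    · intro i j hij
      have h := (zpow_right_mono₀ (one_le_two (α := ℝ))).pairwise_disjoint_on_Ioc_pred hij
      simpa only [Order.pred_eq_sub_one, Function.onFun] using h
  have h2 : ∀ j : ℤ, ((2 ^ (j - 1) : ℝ≥0) : ℝ≥0∞) ≠ 0 := fun j =>
    ENNReal.coe_ne_zero.2 (zpow_ne_zero _ two_ne_zero)
  have hpos : ∀ j : ℤ, φ (2 ^ j) ≠ 0 := by
    intro j h0
    have h1 := (lintegral_Ioc_zpow_ge hk hφ j).trans ((ENNReal.le_tsum j).trans hIoc)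
    rw [h0, ENNReal.coe_zero, ENNReal.div_zero (h2 j), ENNReal.top_rpow_of_pos hq0,
      ENNReal.mul_top (h2 j)] at h1
    exact absurd hA (not_lt.2 h1)
  have hconj : ((k : ℝ) / (k - 1)).HolderConjugate k := by
    rw [Real.holderConjugate_iff]
    refine ⟨(one_lt_div (by linarith)).2 (by linarith), ?_⟩
    field_simp
    ring
  let F : ℤ → ℝ≥0∞ := fun j =>
    ((2 ^ (j - 1) : ℝ≥0) : ℝ≥0∞) * ((φ (2 ^ j) : ℝ≥0∞)⁻¹) ^ (1 / (k : ℝ))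
  let H : ℤ → ℝ≥0∞ := fun j => ((φ (2 ^ j) : ℝ≥0∞) * μ (dyadicLevel g j)) ^ (1 / (k : ℝ))
  have hFH : ∀ j, ((2 ^ (j - 1) : ℝ≥0) : ℝ≥0∞) * μ (dyadicLevel g j) ^ (1 / (k : ℝ)) =
      (F * H) j := fun j => by
    simp only [F, H, Pi.mul_apply]
    rw [mul_assoc, ← ENNReal.mul_rpow_of_nonneg _ _ (by positivity), ← mul_assoc,
      ENNReal.inv_mul_cancel (by exact_mod_cast hpos j) ENNReal.coe_ne_top, one_mul]
  have hF : ∀ j, F j ^ ((k : ℝ) / (k - 1)) ≤ ∫⁻ t in Ioc ((2 : ℝ) ^ (j - 1)) (2 ^ j),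
      (ENNReal.ofReal t / (φ t.toNNReal : ℝ≥0∞)) ^ q := fun j => by
    refine le_of_eq_of_le ?_ (lintegral_Ioc_zpow_ge hk hφ j)
    have e1 : (k : ℝ) / (k - 1) = 1 + q := by rw [hq]; field_simp; ring
    have e2 : 1 / (k : ℝ) * ((k : ℝ) / (k - 1)) = q := by rw [hq]; field_simp
    simp only [F]
    rw [ENNReal.mul_rpow_of_nonneg _ _ hconj.nonneg, ← ENNReal.rpow_mul, e2, e1,
      ENNReal.rpow_add _ _ (h2 j) ENNReal.coe_ne_top, ENNReal.rpow_one, mul_assoc,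
      ← ENNReal.mul_rpow_of_nonneg _ _ hq0.le, ← div_eq_mul_inv]
  have hH : ∀ j, H j ^ (k : ℝ) ≤ ∫⁻ x in dyadicLevel g j, φ (g x) ∂μ := fun j => by
    simp only [H]
    rw [← ENNReal.rpow_mul, one_div_mul_cancel hk0, ENNReal.rpow_one, ← setLIntegral_const]
    exact setLIntegral_mono' (measurableSet_dyadicLevel hg j) fun x hx =>
      ENNReal.coe_le_coe.2 (hφ hx.1)
  simp only [hFH]
  rw [← lintegral_count]
  refine (ENNReal.lintegral_mul_le_Lp_mul_Lq _ hconj (Measurable.of_discrete).aemeasurable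
    (Measurable.of_discrete).aemeasurable).trans ?_
  rw [lintegral_count, lintegral_count, one_div_div]
  refine mul_le_mul' (ENNReal.rpow_le_rpow ?_ ?_) (ENNReal.rpow_le_rpow ?_ ?_)
  · exact (ENNReal.tsum_le_tsum hF).trans hIoc
  · apply div_nonneg <;> linarith
  · refine (ENNReal.tsum_le_tsum hH).trans ?_
    rw [← lintegral_iUnion (measurableSet_dyadicLevel hg) (pairwise_disjoint_dyadicLevel g)]
    exact setLIntegral_le_lintegral _ _
  · positivity

end Dyadic

/-! ### Oscillation of a `C¹` function on a cube -/

theorem lintegral_min_div_pow_le {k : ℕ} (hk : 2 ≤ k) (e : ℝ≥0∞) {l : ℝ} (hl : 0 < l) :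
    ∫⁻ t in Ioc (0 : ℝ) 1, (ENNReal.ofReal (t ^ k))⁻¹ * min e (ENNReal.ofReal (t ^ k * l ^ k)) ≤
      2 * e ^ (1 / (k : ℝ)) * ENNReal.ofReal (l ^ (k - 1)) := by
  have hk' : (2 : ℝ) ≤ k := by exact_mod_cast hk
  have hk0 : 0 < 1 / (k : ℝ) := by positivity
  have hll : ENNReal.ofReal (l ^ (k - 1)) ≠ 0 := by
    rw [ne_eq, ENNReal.ofReal_eq_zero, not_le]; positivity
  rcases eq_or_ne e ⊤ with rfl | he
  · rw [ENNReal.top_rpow_of_pos hk0, ENNReal.mul_top two_ne_zero, ENNReal.top_mul hll]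
    exact le_top
  rcases eq_or_ne e 0 with rfl | he0
  · simp
  obtain ⟨b, hb, hbe⟩ : ∃ b : ℝ, 0 < b ∧ e ^ (1 / (k : ℝ)) = ENNReal.ofReal b := by
    refine ⟨(e ^ (1 / (k : ℝ))).toReal, ENNReal.toReal_pos ?_ ?_, (ENNReal.ofReal_toReal ?_).symm⟩
    · exact (ENNReal.rpow_pos (pos_iff_ne_zero.2 he0) he).ne'
    · exact ENNReal.rpow_ne_top_of_nonneg hk0.le he
    · exact ENNReal.rpow_ne_top_of_nonneg hk0.le he
  have heb : e = ENNReal.ofReal (b ^ k) := by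
    rw [ENNReal.ofReal_pow hb.le, ← hbe, ← ENNReal.rpow_natCast, ← ENNReal.rpow_mul,
      one_div_mul_cancel (by positivity), ENNReal.rpow_one]
  have hlk : l ^ k = l ^ (k - 1) * l := by rw [← pow_succ]; congr 1; omega
  have hbk : b ^ k = b ^ (k - 1) * b := by rw [← pow_succ]; congr 1; omega
  -- the two bounds for the minimum agree at `t = b / l`
  have hsub : Ioc (0 : ℝ) 1 ⊆ Ioc 0 (b / l) ∪ Ioi (b / l) := by
    intro t ht
    rcases le_or_gt t (b / l) with h | h
    · exact .inl ⟨ht.1, h⟩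
    · exact .inr h
  refine (lintegral_mono_set hsub).trans ((lintegral_union_le _ _ _).trans ?_)
  rw [hbe, mul_assoc, two_mul, ← ENNReal.ofReal_mul hb.le]
  refine add_le_add ?_ ?_
  · calc _ ≤ ∫⁻ _ in Ioc 0 (b / l), ENNReal.ofReal (l ^ k) := by
          refine setLIntegral_mono' measurableSet_Ioc fun t ht => ?_
          have htk : 0 < t ^ k := pow_pos ht.1 k
          refine (mul_le_mul_right (min_le_right _ _) _).trans ?_
          rw [ENNReal.ofReal_mul htk.le, ← mul_assoc, ENNReal.inv_mul_cancel (by simpa using htk)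
            ENNReal.ofReal_ne_top, one_mul]
      _ = ENNReal.ofReal (b * l ^ (k - 1)) := by
          rw [setLIntegral_const, Real.volume_Ioc, sub_zero, ← ENNReal.ofReal_mul (by positivity)]
          congr 1
          rw [hlk]
          field_simp
  · have hbl : 0 < b / l := by positivity
    have hint : IntegrableOn (fun t : ℝ => b ^ k * t ^ (-(k : ℝ))) (Ioi (b / l)) :=
      (integrableOn_Ioi_rpow_of_lt (by linarith) hbl).const_mul _
    calc _ ≤ ∫⁻ t in Ioi (b / l), ENNReal.ofReal (b ^ k * t ^ (-(k : ℝ))) := by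
          refine setLIntegral_mono' measurableSet_Ioi fun t ht => ?_
          have ht0 : 0 < t := hbl.trans ht
          refine (mul_le_mul_right (min_le_left _ _) _).trans ?_
          rw [heb, ← ENNReal.ofReal_inv_of_pos (by positivity), ← ENNReal.ofReal_mul (by positivity),
            Real.rpow_neg ht0.le, Real.rpow_natCast, mul_comm]
      _ = ENNReal.ofReal (b ^ k * (-(b / l) ^ (-(k : ℝ) + 1) / (-k + 1))) := by
          rw [← ofReal_integral_eq_lintegral_ofReal hint, integral_const_mul,
            integral_Ioi_rpow_of_lt (by linarith) hbl]
          refine (ae_restrict_iff' measurableSet_Ioi).2 (.of_forall fun t ht => ?_)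
          have ht0 : 0 < t := hbl.trans ht
          positivity
      _ ≤ _ := by
          refine ENNReal.ofReal_le_ofReal ?_
          have e1 : (b / l) ^ (-(k : ℝ) + 1) = ((b / l) ^ (k - 1))⁻¹ := by
            rw [show -(k : ℝ) + 1 = -((k - 1 : ℕ) : ℝ) by rw [Nat.cast_sub (by omega)]; push_cast; ring,
              Real.rpow_neg hbl.le, Real.rpow_natCast]
          have e2 : b ^ k * (-((b / l) ^ (k - 1))⁻¹ / (-(k : ℝ) + 1)) =
              b * l ^ (k - 1) / (k - 1) := by
            have : (-(k : ℝ) + 1) = -(k - 1) := by ring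
            rw [this, neg_div_neg_eq, hbk, div_pow]
            field_simp
          rw [e1, e2]
          exact div_le_self (by positivity) (by linarith)

section Smooth

variable {k : ℕ} {v : EuclideanSpace ℝ (Fin k) → ℝ}

theorem enorm_sub_le_lintegral_fderiv (hv : ContDiff ℝ 1 v) (x y : EuclideanSpace ℝ (Fin k)) :
    ‖v y - v x‖ₑ ≤
      ∫⁻ t in Ioc (0 : ℝ) 1, ‖fderiv ℝ v (AffineMap.homothety x t y)‖ₑ * ‖y - x‖ₑ := by
  have hγ : ∀ t : ℝ, HasDerivAt (fun t : ℝ => AffineMap.homothety x t y) (y - x) t := fun t => by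
    simp only [AffineMap.homothety_apply, vsub_eq_sub, vadd_eq_add]
    simpa using ((hasDerivAt_id t).smul_const (y - x)).add_const x
  have hcont : Continuous fun t : ℝ => fderiv ℝ v (AffineMap.homothety x t y) (y - x) :=
    ((hv.continuous_fderiv one_ne_zero).comp
      (continuous_iff_continuousAt.2 fun t => (hγ t).continuousAt)).clm_apply continuous_const
  have hFTC := intervalIntegral.integral_eq_sub_of_hasDerivAt (a := 0) (b := 1)
    (f := fun t : ℝ => v (AffineMap.homothety x t y))
    (fun t _ => ((hv.differentiable one_ne_zero _).hasFDerivAt.comp_hasDerivAt t (hγ t)))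
    (hcont.intervalIntegrable 0 1)
  simp only [AffineMap.homothety_one, AffineMap.homothety_zero, AffineMap.id_apply,
    AffineMap.const_apply] at hFTC
  rw [← hFTC, intervalIntegral.integral_of_le zero_le_one]
  refine (enorm_integral_le_lintegral_enorm _).trans (lintegral_mono fun t => ?_)
  exact ContinuousLinearMap.le_opENorm _ _

theorem setLIntegral_comp_homothety (x : EuclideanSpace ℝ (Fin k)) {t : ℝ} (ht : 0 < t)
    {S : Set (EuclideanSpace ℝ (Fin k))} (hS : MeasurableSet S)
    (h : EuclideanSpace ℝ (Fin k) → ℝ≥0∞) :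
    ∫⁻ y in S, h (AffineMap.homothety x t y) =
      (ENNReal.ofReal (t ^ k))⁻¹ * ∫⁻ z in AffineMap.homothety x t '' S, h z := by
  have htk : 0 < t ^ k := pow_pos ht k
  have hd : ∀ y ∈ S, HasFDerivWithinAt (AffineMap.homothety x t)
      (t • ContinuousLinearMap.id ℝ (EuclideanSpace ℝ (Fin k))) S y := fun y _ => by
    have : HasFDerivAt (fun y => t • (y - x) + x)
        (t • ContinuousLinearMap.id ℝ (EuclideanSpace ℝ (Fin k))) y :=
      (((hasFDerivAt_id y).sub_const x).const_smul t).add_const x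
    exact this.hasFDerivWithinAt
  have hinj : InjOn (AffineMap.homothety x t) S := by
    intro y _ z _ hyz
    simpa [AffineMap.homothety_apply, ht.ne'] using hyz
  have hdet : |(t • ContinuousLinearMap.id ℝ (EuclideanSpace ℝ (Fin k))).det| = t ^ k := by
    rw [ContinuousLinearMap.det, ContinuousLinearMap.toLinearMap_smul, LinearMap.det_smul]
    simp [abs_of_pos ht]
  rw [lintegral_image_eq_lintegral_abs_det_fderiv_mul volume hS hd hinj]
  simp only [hdet]
  rw [lintegral_const_mul' _ _ ENNReal.ofReal_ne_top, ← mul_assoc,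
    ENNReal.inv_mul_cancel (by simpa using htk) ENNReal.ofReal_ne_top, one_mul]

/-- If the integral of `|∇v|` over subsets of a cube is controlled by their measure, then so is the
mean distance of `v` to its value at a point of the cube. -/
theorem lintegral_enorm_sub_le (hk : 2 ≤ k) (hv : ContDiff ℝ 1 v)
    {a x : EuclideanSpace ℝ (Fin k)} {l : ℝ} (hl : 0 < l) (hx : x ∈ cube a l)
    {ι : Type*} [Countable ι] (c e : ι → ℝ≥0∞)
    (hF : ∀ S ⊆ cube a l, MeasurableSet S →
      ∫⁻ z in S, ‖fderiv ℝ v z‖ₑ ≤ ∑' j, c j * min (e j) (volume S)) :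
    ∫⁻ y in cube a l, ‖v y - v x‖ₑ ≤
      2 * k * ENNReal.ofReal (l ^ k) * ∑' j, c j * e j ^ (1 / (k : ℝ)) := by
  set C := cube a l
  have hCm : MeasurableSet C := (isClosed_cube a l).measurableSet
  have hd : Continuous fun p : ℝ × EuclideanSpace ℝ (Fin k) =>
      fderiv ℝ v (AffineMap.homothety x p.1 p.2) := by
    refine (hv.continuous_fderiv one_ne_zero).comp ?_
    simp only [AffineMap.homothety_apply, vsub_eq_sub, vadd_eq_add]
    fun_prop
  calc ∫⁻ y in C, ‖v y - v x‖ₑ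
      ≤ ∫⁻ y in C, ∫⁻ t in Ioc (0 : ℝ) 1,
          ‖fderiv ℝ v (AffineMap.homothety x t y)‖ₑ * ENNReal.ofReal (k * l) := by
        refine setLIntegral_mono' hCm fun y hy => (enorm_sub_le_lintegral_fderiv hv x y).trans ?_
        gcongr
        rw [← edist_eq_enorm_sub, edist_dist]
        exact ENNReal.ofReal_le_ofReal (dist_le_of_mem_cube hl.le hy hx)
    _ = ∫⁻ t in Ioc (0 : ℝ) 1, ENNReal.ofReal (k * l) *
          ∫⁻ y in C, ‖fderiv ℝ v (AffineMap.homothety x t y)‖ₑ := by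
        rw [lintegral_lintegral_swap]
        · refine lintegral_congr fun t => ?_
          rw [lintegral_mul_const' _ _ ENNReal.ofReal_ne_top, mul_comm]
        · refine (Measurable.mul_const ?_ _).aemeasurable
          exact (hd.comp continuous_swap).measurable.enorm
    _ ≤ ∫⁻ t in Ioc (0 : ℝ) 1, ENNReal.ofReal (k * l) * ∑' j, c j *
          ((ENNReal.ofReal (t ^ k))⁻¹ * min (e j) (ENNReal.ofReal (t ^ k * l ^ k))) := by
        refine setLIntegral_mono' measurableSet_Ioc fun t ht => ?_
        have hsub : AffineMap.homothety x t '' C ⊆ C := by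
          rintro _ ⟨y, hy, rfl⟩
          rw [AffineMap.homothety_eq_lineMap]
          exact (convex_cube a l).lineMap_mem hx hy ⟨ht.1.le, ht.2⟩
        have hm : MeasurableSet (AffineMap.homothety x t '' C) := by
          refine ((isCompact_cube a hl.le).image ?_).measurableSet
          exact AffineMap.homothety_continuous x t
        have hvol : volume (AffineMap.homothety x t '' C) = ENNReal.ofReal (t ^ k * l ^ k) := by
          rw [Measure.addHaar_image_homothety, volume_cube a hl.le, finrank_euclideanSpace_fin,
            abs_of_pos (pow_pos ht.1 k), ENNReal.ofReal_mul (pow_pos ht.1 k).le]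
        rw [setLIntegral_comp_homothety x ht.1 hCm (fun z => ‖fderiv ℝ v z‖ₑ)]
        gcongr
        calc _ ≤ (ENNReal.ofReal (t ^ k))⁻¹ *
              ∑' j, c j * min (e j) (volume (AffineMap.homothety x t '' C)) := by
              gcongr; exact hF _ hsub hm
          _ = _ := by
              rw [← ENNReal.tsum_mul_left, hvol]
              exact tsum_congr fun j => by ring
    _ = ENNReal.ofReal (k * l) * ∑' j, c j * ∫⁻ t in Ioc (0 : ℝ) 1,
          ((ENNReal.ofReal (t ^ k))⁻¹ * min (e j) (ENNReal.ofReal (t ^ k * l ^ k))) := by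
        have hmeas : ∀ j, Measurable fun t : ℝ =>
            (ENNReal.ofReal (t ^ k))⁻¹ * min (e j) (ENNReal.ofReal (t ^ k * l ^ k)) :=
          fun j => by fun_prop
        rw [lintegral_const_mul' _ _ ENNReal.ofReal_ne_top,
          lintegral_tsum fun j => ((hmeas j).const_mul _).aemeasurable]
        congr 1
        exact tsum_congr fun j => lintegral_const_mul _ (hmeas j)
    _ ≤ ENNReal.ofReal (k * l) *
          ∑' j, c j * (2 * e j ^ (1 / (k : ℝ)) * ENNReal.ofReal (l ^ (k - 1))) := by
        gcongr with j
        exact lintegral_min_div_pow_le hk (e j) hl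
    _ = _ := by
        have h1 : ENNReal.ofReal (l ^ k) = ENNReal.ofReal l * ENNReal.ofReal (l ^ (k - 1)) := by
          rw [← ENNReal.ofReal_mul hl.le, ← pow_succ']; congr 2; omega
        rw [ENNReal.ofReal_mul (by positivity), ENNReal.ofReal_natCast, h1,
          ← ENNReal.tsum_mul_left, ← ENNReal.tsum_mul_left]
        exact tsum_congr fun j => by ring

/-- The oscillation bound that results from averaging `lintegral_enorm_sub_le` at two points; the
constant does not depend on the cube. -/
theorem enorm_sub_le_of_mem_cube (hk : 2 ≤ k) (hv : ContDiff ℝ 1 v)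
    {a x x' : EuclideanSpace ℝ (Fin k)} {l : ℝ} (hl : 0 < l) (hx : x ∈ cube a l)
    (hx' : x' ∈ cube a l) {ι : Type*} [Countable ι] (c e : ι → ℝ≥0∞)
    (hF : ∀ S ⊆ cube a l, MeasurableSet S →
      ∫⁻ z in S, ‖fderiv ℝ v z‖ₑ ≤ ∑' j, c j * min (e j) (volume S)) :
    ‖v x - v x'‖ₑ ≤ 4 * k * ∑' j, c j * e j ^ (1 / (k : ℝ)) := by
  have hV0 : ENNReal.ofReal (l ^ k) ≠ 0 := by
    rw [ne_eq, ENNReal.ofReal_eq_zero, not_le]; positivity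
  refine (ENNReal.mul_le_mul_iff_left hV0 ENNReal.ofReal_ne_top).1 ?_
  calc ‖v x - v x'‖ₑ * ENNReal.ofReal (l ^ k) = ∫⁻ _ in cube a l, ‖v x - v x'‖ₑ := by
        rw [setLIntegral_const, volume_cube a hl.le]
    _ ≤ ∫⁻ y in cube a l, (‖v y - v x‖ₑ + ‖v y - v x'‖ₑ) := by
        refine lintegral_mono fun y => ?_
        simp only [← edist_eq_enorm_sub]
        exact (edist_triangle_left _ _ (v y))
    _ = (∫⁻ y in cube a l, ‖v y - v x‖ₑ) + ∫⁻ y in cube a l, ‖v y - v x'‖ₑ := by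
        refine lintegral_add_left ?_ _
        exact (hv.continuous.sub continuous_const).measurable.enorm
    _ ≤ _ := add_le_add (lintegral_enorm_sub_le hk hv hl hx c e hF)
        (lintegral_enorm_sub_le hk hv hl hx' c e hF)
    _ = _ := by ring

end Smooth

/-! ### Mollification -/

section Mollification

open scoped Convolution

variable {k : ℕ}

/-- At a point whose distance to the complement of `C` exceeds the radius of the mollifier, the
gradient of the mollified function is the mollified weak gradient. -/
theorem fderiv_convolution_normed_eq {G C : Set (EuclideanSpace ℝ (Fin k))}
    {u : EuclideanSpace ℝ (Fin k) → ℝ} {g : EuclideanSpace ℝ (Fin k) → Fin k → ℝ}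
    (hw : ∀ j, IsWeakPartialDeriv G u (fun x => g x j) j) (hG : IsOpen G) (hCG : C ⊆ G)
    (hu : Integrable (C.indicator u))
    (hg : Integrable (C.indicator fun y => WithLp.toLp 2 (g y)))
    (η : ContDiffBump (0 : EuclideanSpace ℝ (Fin k))) {x : EuclideanSpace ℝ (Fin k)}
    (hx : Metric.closedBall x η.rOut ⊆ C) :
    fderiv ℝ (η.normed volume ⋆[ContinuousLinearMap.lsmul ℝ ℝ] C.indicator u) x =
      innerSL ℝ (∫ y, η.normed volume (x - y) • C.indicator (fun y => WithLp.toLp 2 (g y)) y) := by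
  set ρ := η.normed volume with hρ
  have hρc : ContDiff ℝ ∞ ρ := η.contDiff_normed
  have hρ1 : ContDiff ℝ 1 ρ := η.contDiff_normed
  have hρs : HasCompactSupport ρ := η.hasCompactSupport_normed
  have hsupp : ∀ y, y ∉ C → x - y ∉ tsupport ρ := by
    intro y hy h
    rw [hρ, η.tsupport_normed_eq, mem_closedBall_zero_iff, ← dist_eq_norm] at h
    exact hy (hx (by rwa [Metric.mem_closedBall, dist_comm]))
  have hint : Integrable fun y =>
      ρ (x - y) • C.indicator (fun y => WithLp.toLp 2 (g y)) y := by
    obtain ⟨c, hc⟩ := hρs.exists_bound_of_continuous hρc.continuous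
    exact hg.bdd_smul c (hρc.continuous.comp (by fun_prop)).aestronglyMeasurable
      (.of_forall fun y => hc _)
  rw [← convolution_flip, (hρs.hasFDerivAt_convolution_right _ hu.locallyIntegrable hρ1 x).fderiv]
  refine ContinuousLinearMap.coe_injective
    ((EuclideanSpace.basisFun (Fin k) ℝ).toBasis.ext fun j => ?_)
  simp only [OrthonormalBasis.coe_toBasis, EuclideanSpace.basisFun_apply,
    ContinuousLinearMap.coe_coe]
  rw [convolution_precompR_apply _ hu.locallyIntegrable (hρs.fderiv ℝ)
    (hρ1.continuous_fderiv one_ne_zero), convolution_def]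
  have hR : innerSL ℝ (∫ y, ρ (x - y) • C.indicator (fun y => WithLp.toLp 2 (g y)) y)
      (EuclideanSpace.single j 1) = ∫ y in G, g y j * ρ (x - y) := by
    rw [innerSL_apply_apply, EuclideanSpace.inner_single_right]
    simp only [one_mul, conj_trivial]
    have h1 := (EuclideanSpace.proj (𝕜 := ℝ) j :
      EuclideanSpace ℝ (Fin k) →L[ℝ] ℝ).integral_comp_comm hint
    rw [show ∀ w : EuclideanSpace ℝ (Fin k), w j = EuclideanSpace.proj (𝕜 := ℝ) j w from
      fun _ => rfl, ← h1, ← integral_indicator hG.measurableSet]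
    refine integral_congr_ae (.of_forall fun y => ?_)
    by_cases hy : y ∈ C
    · simp [hy, hCG hy, mul_comm]
    · have : ρ (x - y) = 0 := image_eq_zero_of_notMem_tsupport (hsupp y hy)
      simp [this, indicator]
  rw [hR]
  have hψ : ContDiff ℝ ∞ fun y => ρ (x - y) := hρc.comp (contDiff_const.sub contDiff_id)
  have hψd : ∀ y, fderiv ℝ (fun y => ρ (x - y)) y = -fderiv ℝ ρ (x - y) := fun y => by
    have h1 := ((hρ1.differentiable one_ne_zero (x - y)).hasFDerivAt.comp y
      ((hasFDerivAt_id y).const_sub x)).fderiv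
    simpa using! h1
  have hψt : tsupport (fun y => ρ (x - y)) ⊆ Metric.closedBall x η.rOut := by
    refine closure_minimal (fun y hy => ?_) Metric.isClosed_closedBall
    have h := subset_tsupport ρ (show x - y ∈ Function.support ρ from hy)
    rw [hρ, η.tsupport_normed_eq, mem_closedBall_zero_iff, ← dist_eq_norm] at h
    rwa [Metric.mem_closedBall, dist_comm]
  have h := (hw j).2.2 (fun y => ρ (x - y)) hψ
    ((isCompact_closedBall x η.rOut).of_isClosed_subset (isClosed_tsupport _) hψt)
    (hψt.trans (hx.trans hCG))
  rw [← neg_eq_iff_eq_neg, ← integral_neg] at h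
  rw [← h, ← integral_indicator hG.measurableSet]
  refine integral_congr_ae (.of_forall fun y => ?_)
  by_cases hy : y ∈ C
  · simp [hy, hCG hy, hψd, mul_comm]
  · have : fderiv ℝ ρ (x - y) = 0 := fderiv_of_notMem_tsupport (𝕜 := ℝ) (hsupp y hy)
    simp [hy, hψd, this, indicator]

/-- Averaging over translations does not increase the supremum of the integrals over translates of
a set. -/
theorem setLIntegral_convolution_le {ρ h : EuclideanSpace ℝ (Fin k) → ℝ≥0∞} (hρ : Measurable ρ)
    (hh : Measurable h) (hρ1 : ∫⁻ y, ρ y = 1) {B : ℝ≥0∞} {S : Set (EuclideanSpace ℝ (Fin k))}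
    (hS : MeasurableSet S) (hB : ∀ T, volume T = volume S → ∫⁻ z in T, h z ≤ B) :
    ∫⁻ x in S, ∫⁻ y, ρ (x - y) * h y ≤ B := by
  calc ∫⁻ x in S, ∫⁻ y, ρ (x - y) * h y = ∫⁻ x in S, ∫⁻ y, ρ y * h (x - y) := by
        refine lintegral_congr fun x => ?_
        rw [← lintegral_sub_left_eq_self _ x]
        simp only [sub_sub_cancel]
    _ = ∫⁻ y, ρ y * ∫⁻ x in S, h (x - y) := by
        rw [lintegral_lintegral_swap]
        · refine lintegral_congr fun y => lintegral_const_mul _ ?_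
          fun_prop
        · apply Measurable.aemeasurable
          fun_prop
    _ ≤ ∫⁻ y, ρ y * B := by
        gcongr with y
        have hmp : MeasurePreserving (fun x : EuclideanSpace ℝ (Fin k) => x - y) volume volume :=
          measurePreserving_sub_right volume y
        have hS' : (fun x => x - y) ⁻¹' ((fun x => x + y) ⁻¹' S) = S := by ext; simp
        have hm : MeasurableSet ((fun x => x + y) ⁻¹' S) := hS.preimage (by fun_prop)
        have := hmp.setLIntegral_comp_preimage hm hh
        rw [hS'] at this
        rw [this]
        refine hB _ ?_
        rw [measure_preimage_add_right]
    _ = B := by rw [lintegral_mul_const _ hρ, hρ1, one_mul]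

/-- The oscillation of a continuous Sobolev function on a cube is controlled by the measures of the
dyadic level sets of its gradient. -/
theorem enorm_sub_le_tsum (hk : 2 ≤ k) {G : Set (EuclideanSpace ℝ (Fin k))}
    {u : EuclideanSpace ℝ (Fin k) → ℝ} {g : EuclideanSpace ℝ (Fin k) → Fin k → ℝ}
    (hw : ∀ j, IsWeakPartialDeriv G u (fun x => g x j) j) (hG : IsOpen G)
    (hu : ContinuousOn u G) {a : EuclideanSpace ℝ (Fin k)} {l : ℝ} (hl : 0 < l)
    (hCG : cube a l ⊆ G) (hg : Integrable ((cube a l).indicator fun y => WithLp.toLp 2 (g y)))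
    {h : EuclideanSpace ℝ (Fin k) → ℝ≥0} (hh : Measurable h)
    (hgh : (fun y => ‖(cube a l).indicator (fun y => WithLp.toLp 2 (g y)) y‖₊) =ᵐ[volume] h)
    {x x' : EuclideanSpace ℝ (Fin k)} (hx : x ∈ cube a l) (hx' : x' ∈ cube a l) :
    ‖u x - u x'‖ₑ ≤ 4 * k *
      ∑' j : ℤ, ((2 ^ (j + 1) : ℝ≥0) : ℝ≥0∞) * volume (dyadicLevel h j) ^ (1 / (k : ℝ)) := by
  set C := cube a l with hC
  set T := 4 * k *
      ∑' j : ℤ, ((2 ^ (j + 1) : ℝ≥0) : ℝ≥0∞) * volume (dyadicLevel h j) ^ (1 / (k : ℝ))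
  have hCm : MeasurableSet C := (isClosed_cube a l).measurableSet
  have hui : Integrable (C.indicator u) :=
    (integrable_indicator_iff hCm).2
      ((hu.mono hCG).integrableOn_compact (isCompact_cube a hl.le))
  -- points of a smaller concentric cube
  have hin : ∀ s, 0 < s → 2 * s < l →
      ∀ y ∈ cube (WithLp.toLp 2 fun i => a i + s) (l - 2 * s),
      ∀ y' ∈ cube (WithLp.toLp 2 fun i => a i + s) (l - 2 * s), ‖u y - u y'‖ₑ ≤ T := by
    intro s hs hsl y hy y' hy'
    set C' := cube (WithLp.toLp 2 fun i => a i + s) (l - 2 * s)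
    have hball : ∀ z ∈ C', Metric.closedBall z s ⊆ C := by
      intro z hz w hw i
      have h1 : |w i - z i| ≤ s :=
        (PiLp.norm_apply_le (w - z) i).trans
          (by simpa [dist_eq_norm] using hw)
      have h2 := hz i
      simp only at h2
      rw [abs_le] at h1
      constructor <;> linarith
    let η : ℕ → ContDiffBump (0 : EuclideanSpace ℝ (Fin k)) := fun n =>
      ⟨s / (n + 2), s / (n + 1), by positivity, by gcongr; norm_num⟩
    have hη : Tendsto (fun n => (η n).rOut) atTop (𝓝 0) := by
      simpa [η, div_eq_mul_inv] using
        (tendsto_one_div_add_atTop_nhds_zero_nat (𝕜 := ℝ)).const_mul s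
    have hηs : ∀ n, (η n).rOut ≤ s := fun n =>
      div_le_self hs.le (by linarith [Nat.cast_nonneg (α := ℝ) n])
    have hlim : ∀ z ∈ C', Tendsto (fun n => ((η n).normed volume
        ⋆[ContinuousLinearMap.lsmul ℝ ℝ] C.indicator u) z) atTop (𝓝 (u z)) := by
      intro z hz
      have hnhds : C ∈ 𝓝 z := mem_of_superset (Metric.closedBall_mem_nhds z hs) (hball z hz)
      have hcont : Tendsto (C.indicator u) (𝓝 z) (𝓝 (u z)) := by
        refine ((hu.mono hCG).continuousAt hnhds).tendsto.congr' ?_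
        filter_upwards [hnhds] with w hw
        rw [indicator_of_mem hw]
      exact ContDiffBump.convolution_tendsto_right hη
        (.of_forall fun _ => hui.aestronglyMeasurable) (hcont.comp tendsto_snd) tendsto_const_nhds
    have hbound : ∀ n, ‖((η n).normed volume ⋆[ContinuousLinearMap.lsmul ℝ ℝ] C.indicator u) y -
        ((η n).normed volume ⋆[ContinuousLinearMap.lsmul ℝ ℝ] C.indicator u) y'‖ₑ ≤ T := by
      intro n
      refine enorm_sub_le_of_mem_cube hk ((η n).hasCompactSupport_normed.contDiff_convolution_left
        (n := 1) _ (η n).contDiff_normed hui.locallyIntegrable) (by linarith) hy hy'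
        (fun j : ℤ => ((2 ^ (j + 1) : ℝ≥0) : ℝ≥0∞)) (fun j => volume (dyadicLevel h j)) ?_
      intro S hSC hS
      have hfd : ∀ z ∈ S, ‖fderiv ℝ ((η n).normed volume
          ⋆[ContinuousLinearMap.lsmul ℝ ℝ] C.indicator u) z‖ₑ ≤
          ∫⁻ w, ‖(η n).normed volume (z - w)‖ₑ * (h w : ℝ≥0∞) := by
        intro z hz
        rw [fderiv_convolution_normed_eq hw hG hCG hui hg (η n)
          ((Metric.closedBall_subset_closedBall (hηs n)).trans (hball z (hSC hz))),
          ← ofReal_norm, innerSL_apply_norm, ofReal_norm]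
        refine (enorm_integral_le_lintegral_enorm _).trans_eq (lintegral_congr_ae ?_)
        filter_upwards [hgh] with w hw
        rw [enorm_smul, ← hw]
        rfl
      refine (setLIntegral_mono' hS hfd).trans ?_
      refine setLIntegral_convolution_le (ρ := fun w => ‖(η n).normed volume w‖ₑ)
        (h := fun w => (h w : ℝ≥0∞)) (η n).continuous_normed.measurable.enorm
        hh.coe_nnreal_ennreal ?_ hS fun T hT => ?_
      · have h1 := ofReal_integral_eq_lintegral_ofReal (η n).integrable_normed
          (.of_forall (η n).nonneg_normed) (μ := volume)
        rw [(η n).integral_normed, ENNReal.ofReal_one] at h1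
        rw [h1]
        refine lintegral_congr fun w => ?_
        rw [Real.enorm_eq_ofReal ((η n).nonneg_normed w)]
      · rw [← hT]
        exact setLIntegral_le_tsum_min hh T
    exact le_of_tendsto ((hlim y hy).sub (hlim y' hy')).enorm (.of_forall hbound)
  -- move both points towards the centre of the cube
  let c : EuclideanSpace ℝ (Fin k) := WithLp.toLp 2 fun i => a i + l / 2
  have hc : c ∈ C := fun i => by simp only [c]; constructor <;> linarith
  have hpath : ∀ y ∈ C, Tendsto (fun t : ℝ => u (AffineMap.lineMap y c t)) (𝓝[Ioo 0 1] 0)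
      (𝓝 (u y)) := by
    intro y hy
    have h1 : Tendsto (fun t : ℝ => AffineMap.lineMap y c t) (𝓝[Ioo 0 1] 0) (𝓝[C] y) := by
      refine tendsto_nhdsWithin_iff.2 ⟨?_, ?_⟩
      · have := (AffineMap.lineMap_continuous (p := y) (q := c) (R := ℝ)).tendsto 0
        rw [AffineMap.lineMap_apply_zero] at this
        exact this.mono_left nhdsWithin_le_nhds
      · filter_upwards [self_mem_nhdsWithin] with t ht
        exact (convex_cube a l).lineMap_mem hy hc ⟨ht.1.le, ht.2.le⟩
    exact ((hu.mono hCG) y hy).tendsto.comp h1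
  have hne : (𝓝[Ioo (0 : ℝ) 1] 0).NeBot := left_nhdsWithin_Ioo_neBot one_pos
  have hlim := ((hpath x hx).sub (hpath x' hx')).enorm
  refine le_of_tendsto hlim ?_
  filter_upwards [self_mem_nhdsWithin] with t ht
  have hmem : ∀ y ∈ C, AffineMap.lineMap y c t ∈
      cube (WithLp.toLp 2 fun i => a i + t * l / 2) (l - 2 * (t * l / 2)) := by
    intro y hy i
    have h1 := hy i
    have h2 := ht.1
    have h3 := ht.2
    simp only [AffineMap.lineMap_apply_module, PiLp.add_apply, PiLp.smul_apply, smul_eq_mul, c]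
    constructor <;> nlinarith
  exact hin (t * l / 2) (by have := ht.1; positivity) (by nlinarith [ht.2]) _ (hmem x hx) _
    (hmem x' hx')

end Mollification

/-! ### Existence of a Calderón constant -/

theorem isCalderonConstant {k : ℕ} (hk : 2 ≤ k) : IsCalderonConstant k (16 * k) := by
  intro φ hφ hφ0 hA G hG _ f Df hf hW a l hl hC
  have hCm : MeasurableSet (cube a l) := (isClosed_cube a l).measurableSet
  have hCc := isCompact_cube a hl.le
  set g₀ := (cube a l).indicator fun y => WithLp.toLp 2 (Df y 0) with hg₀
  have hg : Integrable g₀ := by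
    rw [hg₀, integrable_indicator_iff hCm]
    refine Integrable.of_eval_piLp fun j => ?_
    exact (hW.weakDeriv 0 j).2.1.mono_set hC |>.integrableOn_isCompact hCc
  obtain ⟨h, hh, hgh⟩ := hg.aestronglyMeasurable.nnnorm
  have hnorm : ∀ x, ‖(WithLp.toLp 2 (Df x 0) : EuclideanSpace ℝ (Fin k))‖₊ = gradNorm (Df x) := by
    intro x
    rw [EuclideanSpace.nnnorm_eq, gradNorm, Fin.sum_univ_one]
  have hI : ∫⁻ x, (φ (h x) : ℝ≥0∞) = ∫⁻ x in cube a l, (φ (gradNorm (Df x)) : ℝ≥0∞) := by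
    rw [← lintegral_indicator hCm]
    refine lintegral_congr_ae ?_
    filter_upwards [hgh] with x hx
    rw [← hx]
    by_cases hxC : x ∈ cube a l
    · simp [hg₀, hxC, hnorm]
    · simp [hg₀, hxC, hφ0]
  rw [← hI]
  refine Metric.ediam_le ?_
  rintro _ ⟨x, hx, rfl⟩ _ ⟨x', hx', rfl⟩
  have hosc := enorm_sub_le_tsum hk (fun j => hW.weakDeriv 0 j) hG (u := fun x => f x 0)
    (by fun_prop) hl hC hg hh.measurable hgh hx hx'
  have he : edist (f x) (f x') = ‖f x 0 - f x' 0‖ₑ := by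
    rw [EuclideanSpace.edist_eq, Fin.sum_univ_one, ← ENNReal.rpow_natCast, ← ENNReal.rpow_mul,
      edist_eq_enorm_sub]
    norm_num
  rw [he]
  refine hosc.trans ?_
  have h4 : ∑' j : ℤ, ((2 ^ (j + 1) : ℝ≥0) : ℝ≥0∞) * volume (dyadicLevel h j) ^ (1 / (k : ℝ)) =
      4 * ∑' j : ℤ, ((2 ^ (j - 1) : ℝ≥0) : ℝ≥0∞) * volume (dyadicLevel h j) ^ (1 / (k : ℝ)) := by
    rw [← ENNReal.tsum_mul_left]
    refine tsum_congr fun j => ?_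
    have : (2 ^ (j + 1) : ℝ≥0) = 4 * 2 ^ (j - 1) := by
      rw [show j + 1 = 2 + (j - 1) by ring, zpow_add₀ two_ne_zero]
      norm_num
    rw [this, ENNReal.coe_mul, mul_assoc]
    rfl
  rw [h4]
  calc _ = 16 * k * ∑' j : ℤ,
        ((2 ^ (j - 1) : ℝ≥0) : ℝ≥0∞) * volume (dyadicLevel h j) ^ (1 / (k : ℝ)) := by ring
    _ ≤ 16 * k * (calderonIntegral k φ 0 ^ (((k : ℝ) - 1) / k) *
          (∫⁻ x, (φ (h x) : ℝ≥0∞)) ^ (1 / (k : ℝ))) := by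
        gcongr
        exact tsum_dyadicLevel_le hk hφ hA hh.measurable
    _ = _ := by
        push_cast
        ring

end OrliczSobolev

end

theorem theorem4p1 (k : ℕ) (hk : 2 ≤ k) :
    (∃ α : ℝ≥0, OrliczSobolev.IsCalderonConstant k α) ∧
    ∀ α : ℝ≥0, OrliczSobolev.IsCalderonConstant k α →
      ∀ m : ℕ, 1 ≤ m →
      ∀ φ : ℝ≥0 → ℝ≥0, Monotone φ → φ 0 = 0 → 0 < φ 1 →
        OrliczSobolev.calderonIntegral k φ 1 < ⊤ →
      ∀ Ω : Set (EuclideanSpace ℝ (Fin k)), IsOpen Ω →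
      ∀ (f : EuclideanSpace ℝ (Fin k) → EuclideanSpace ℝ (Fin m))
        (Df : EuclideanSpace ℝ (Fin k) → Matrix (Fin m) (Fin k) ℝ),
        ContinuousOn f Ω → OrliczSobolev.MemOrliczSobolev φ Ω f Df →
        (∀ E ⊆ Ω, NullMeasurableSet E volume →
          Measure.hausdorffMeasure (k : ℝ) (f '' E) ≤
            ((m : ℝ≥0∞) * (α : ℝ≥0∞)) ^ k * OrliczSobolev.aStar k φ ^ (k - 1) *
              ∫⁻ x in E, (OrliczSobolev.phiStar φ (OrliczSobolev.gradNorm (Df x)) : ℝ≥0∞)) ∧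
        (∀ E ⊆ Ω, volume E = 0 → Measure.hausdorffMeasure (k : ℝ) (f '' E) = 0) ∧
        (∀ E ⊆ Ω, NullMeasurableSet E volume →
          (∀ᵐ x ∂(volume.restrict E), Df x = 0) →
            Measure.hausdorffMeasure (k : ℝ) (f '' E) = 0) := by
  refine ⟨⟨16 * k, OrliczSobolev.isCalderonConstant hk⟩, ?_⟩
  intro α hα m _ φ hφ _ h1 hA Ω hΩ f Df hf hW
  have key := fun E (hE : E ⊆ Ω) =>
    OrliczSobolev.hausdorffMeasure_image_le_lintegral hk hα hφ h1 hA hΩ hf hW hE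
  refine ⟨fun E hE _ => key E hE, fun E hE h0 => ?_, fun E hE _ hD => ?_⟩
  · refine nonpos_iff_eq_zero.1 ((key E hE).trans_eq ?_)
    rw [setLIntegral_measure_zero _ _ h0, mul_zero]
  · refine nonpos_iff_eq_zero.1 ((key E hE).trans_eq ?_)
    have hz : ∀ᵐ x ∂(volume.restrict E),
        (OrliczSobolev.phiStar φ (OrliczSobolev.gradNorm (Df x)) : ℝ≥0∞) = 0 := by
      filter_upwards [hD] with x hx
      simp [OrliczSobolev.gradNorm_eq_zero hx]
    rw [lintegral_congr_ae hz, lintegral_zero, mul_zero]
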